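/- Let $n$ be a natural number, $s\in(0,1)$, $T>0$, and let $\omega\subset\mathbb R^n$ be Lebesgue measurable. Consider the fractional heat equation \[ \partial_t f(t,x)+(-\Delta)^{s/2}f(t,x)=\mathbf 1_\omega(x)\,u(t,x),\qquad f(0,\cdot)=f_0\in L^2(\mathbb R^n), \] where $(-\Delta)^{s/2}$ is the Fourier multiplier with symbol $|\xi|^s$. The equation is called null-controllable from $\omega$ at time $T$ if for every $f_0\in L^2(\mathbb R^n)$ there is a control $u\in L^2((0,T)\times\omega)$ such that the mild solution \[ f(t)=e^{-t(-\Delta)^{s/2}}f_0+\int_0^t e^{-(t-\tau)(-\Delta)^{s/2}}\bigl(\mathbf 1_\omega u(\tau)\bigr)\,d\tau ,\qquad 0\le t\le T, \] satisfies $f(T)=0$. If the equation is null-controllable from $\omega$ at time $T$, then $\omega$ is $\frac{2s}{1-s}$-exponentially thick, that is, there exist $C>0$, $c>0$ and $L_0>0$ such that for every $0<L<L_0$ and every $x\in\mathbb R^n$, \[ \operatorname{Leb}\bigl(\omega\cap B(x,L)\bigr)\ \ge\ c\,e^{-C L^{-2s/(1-s)}}\operatorname{Leb}\bigl(B(x,L)\bigr).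 \] -/

import Mathlib

open MeasureTheory Set
open scoped FourierTransform ENNReal

namespace FracHeat

/-- The Euclidean space `ℝⁿ`. -/
abbrev E (n : ℕ) : Type := EuclideanSpace ℝ (Fin n)

/-- The complex Hilbert space `L²(ℝⁿ)` (Lebesgue measure). -/
abbrev L2 (n : ℕ) : Type := Lp ℂ 2 (volume : Measure (E n))

/-- The Fourier symbol of `exp (-t (-Δ)^{s/2})` for `t ≥ 0`. Mathlib's Fourier transform is
`𝓕 f ξ = ∫ exp (-2πi ⟪x, ξ⟫) f x dx`, so `-Δ` has symbol `(2π‖ξ‖)²` and `(-Δ)^{s/2}` has symbol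
`(2π‖ξ‖)^s`. Only `t ≥ 0` matters; negative times are replaced by `0`. -/
noncomputable def heatSymbol {n : ℕ} (s t : ℝ) (ξ : E n) : ℂ :=
  ((Real.exp (-(max t 0 * (2 * Real.pi * ‖ξ‖) ^ s)) : ℝ) : ℂ)

theorem norm_heatSymbol_le {n : ℕ} (s t : ℝ) (ξ : E n) : ‖heatSymbol s t ξ‖ ≤ 1 := by
  rw [heatSymbol, Complex.norm_real, Real.norm_eq_abs, Real.abs_exp, Real.exp_le_one_iff]
  have h : 0 ≤ (2 * Real.pi * ‖ξ‖) ^ s := by positivity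
  have := mul_nonneg (le_max_right t 0) h
  linarith

theorem measurable_heatSymbol {n : ℕ} (s t : ℝ) : Measurable (heatSymbol (n := n) s t) := by
  unfold heatSymbol
  fun_prop

theorem memLp_heatSymbol_mul {n : ℕ} (s t : ℝ) (g : L2 n) :
    MemLp (fun ξ => heatSymbol s t ξ * g ξ) 2 volume := by
  refine MemLp.of_le (Lp.memLp g)
    ((measurable_heatSymbol s t).aestronglyMeasurable.mul (Lp.aestronglyMeasurable g)) ?_
  filter_upwards with ξ
  rw [norm_mul]
  exact mul_le_of_le_one_left (norm_nonneg _) (norm_heatSymbol_le s t ξ)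

/-- The fractional heat semigroup `exp (-t (-Δ)^{s/2})`, `t ≥ 0`, on `L²(ℝⁿ)`: the Fourier
multiplier with symbol `heatSymbol s t` (`𝓕` is the Fourier-Plancherel transform on `L²`). -/
noncomputable def heatSemigroup {n : ℕ} (s t : ℝ) (f : L2 n) : L2 n :=
  𝓕⁻ (memLp_heatSymbol_mul s t (𝓕 f)).toLp

/-- `f` is the mild solution on `[0, T]` of `∂ₜ f + (-Δ)^{s/2} f = 1_ω u`, `f(0) = f₀`, given by
Duhamel's formula in `L²(ℝⁿ)`. Here `U` is the source term `1_ω u` seen as an element of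
`L²((0, T); L²(ℝⁿ))` through the canonical identification with `L²((0, T) × ℝⁿ)`. -/
def IsMildSolution {n : ℕ} (s T : ℝ) (ω : Set (E n)) (f₀ : L2 n) (u : ℝ → E n → ℂ)
    (f : ℝ → L2 n) : Prop :=
  ∃ U : ℝ → L2 n,
    MemLp U 2 (volume.restrict (Ioo 0 T)) ∧
    (∀ᵐ τ ∂(volume.restrict (Ioo 0 T)), U τ =ᵐ[volume] ω.indicator (u τ)) ∧
    ∀ t ∈ Icc 0 T,
      IntegrableOn (fun τ => heatSemigroup s (t - τ) (U τ)) (Ioo 0 t) ∧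
      f t = heatSemigroup s t f₀ + ∫ τ in Ioo 0 t, heatSemigroup s (t - τ) (U τ)

/-- Null-controllability from `ω` in time `T`: every initial datum in `L²(ℝⁿ)` can be steered to
`0` at time `T` by a control `u ∈ L²((0, T) × ω)`. -/
def NullControllable {n : ℕ} (s T : ℝ) (ω : Set (E n)) : Prop :=
  ∀ f₀ : L2 n, ∃ u : ℝ → E n → ℂ,
    MemLp (Function.uncurry u) 2
      ((volume.restrict (Ioo 0 T)).prod (volume.restrict ω)) ∧
    ∃ f : ℝ → L2 n, IsMildSolution s T ω f₀ u f ∧ f T = 0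

/-- `α`-exponential thickness of a (Lebesgue measurable) set `ω ⊆ ℝⁿ`. -/
def ExponentiallyThick {n : ℕ} (α : ℝ) (ω : Set (E n)) : Prop :=
  NullMeasurableSet ω volume ∧
    ∃ C > 0, ∃ c > 0, ∃ L₀ > 0, ∀ L : ℝ, 0 < L → L < L₀ → ∀ x : E n,
      ENNReal.ofReal (c * Real.exp (-C * L ^ (-α))) * volume (Metric.ball x L) ≤
        volume (ω ∩ Metric.ball x L)

end FracHeat

/-! ### Duality on the Fourier side and weak observability. -/

namespace FracHeat

/-! By duality, null-controllability bounds the evolved state at time `T` by its size on `ω` over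
`[0, T]` (`NullControllable.observability`). This is tested on coherent states centred at `x₀` with
frequency of norm `ρ`, of width about `ρ^(-1/2)` in space. At time `T` such a state still has norm
at least a multiple of `exp (-A ρ^s)`, with `A = T (4π)^s`.

It must also stay localised near `x₀`. With `v = 1 - ‖ξ‖²/ρ²` and `w = exp v`, the heat symbol
extends holomorphically in `w` to the unit disc about `1`, bounded by `1` uniformly in time. Its
Taylor polynomial of degree below `N` is a combination of powers of `w`, which are Gaussians in `ξ`;
applied to a coherent state they give explicit Gaussians about `x₀`, at a cost `8^N`. The remainder
is of order `2^(-N)` near the carrier frequency, and at most `4^N exp (-γ ρ)` for a fixed `γ > 0`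
elsewhere (`eLpNorm_heatSemigroup_packet_le`).

Since `s < 1`, `N` may be a large multiple of `ρ^s`, which makes the remainder negligible. The part
outside `B(x₀, L)` is negligible once `ρ L²` is a large multiple of `ρ^s`, that is `ρ^s ∼
L^(-2s/(1-s))`. The mass in `ω ∩ B(x₀, L)` must then supply the lower bound. -/

theorem fourierInv_ae_eq {n : ℕ} (F : L2 n) (hF : Integrable F volume) :
    (𝓕⁻ F : L2 n) =ᵐ[volume] 𝓕⁻ (F : E n → ℂ) := by
  have hcont : Continuous (𝓕⁻ (F : E n → ℂ)) :=
    VectorFourier.fourierIntegral_continuous Real.continuous_fourierChar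
      (by exact (continuous_inner (𝕜 := ℝ) (E := E n)).neg) hF
  -- Both sides are compared against test functions: the `L²` transform through tempered
  -- distributions, the integral transform through Fubini.
  refine ae_eq_of_integral_contDiff_smul_eq
    ((Lp.memLp _).locallyIntegrable (by norm_num)) hcont.locallyIntegrable ?_
  intro g hg hgc
  have hg' : ContDiff ℝ (⊤ : ℕ∞) (fun x => (g x : ℂ)) := Complex.ofRealCLM.contDiff.comp hg
  have hgc' : HasCompactSupport (fun x => (g x : ℂ)) := hgc.comp_left (g := fun y : ℝ => (y : ℂ)) rfl
  set φ : SchwartzMap (E n) ℂ := hgc'.toSchwartzMap hg' with hφ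
  have hφx : ∀ x, φ x = (g x : ℂ) := fun x => rfl
  have h1 := congrArg (fun D => D φ) (Lp.fourierInv_toTemperedDistribution_eq F)
  simp only [TemperedDistribution.fourierInv_apply, Lp.toTemperedDistribution_apply] at h1
  have h2 : ∫ ξ : E n, (𝓕⁻ (φ : E n → ℂ)) ξ • F ξ = ∫ x : E n, φ x • 𝓕⁻ (F : E n → ℂ) x :=
    VectorFourier.integral_fourierIntegral_smul_eq_flip (L := -innerₗ (E n))
      Real.continuous_fourierChar
      (by exact (continuous_inner (𝕜 := ℝ) (E := E n)).neg) φ.integrable hF |>.trans (by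
        congr 1; ext x; congr 2; ext a b; simp [real_inner_comm])
  rw [SchwartzMap.fourierInv_coe] at h1
  rw [h2] at h1
  simp only [hφx] at h1
  simpa using h1.symm

/-- Plancherel reduces this to the symbol being real. -/
theorem inner_heatSemigroup {n : ℕ} (s t : ℝ) (f g : L2 n) :
    inner ℂ (heatSemigroup s t f) g = inner ℂ f (heatSemigroup s t g) := by
  have key : ∀ a b : L2 n, inner ℂ (𝓕⁻ a) b = inner ℂ a (𝓕 b) := fun a b => by
    rw [← Lp.inner_fourier_eq, FourierTransform.fourier_fourierInv_eq]
  rw [heatSemigroup, key, ← inner_conj_symm f, heatSemigroup, key, inner_conj_symm,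
    L2.inner_def, L2.inner_def]
  refine integral_congr_ae ?_
  filter_upwards [(memLp_heatSymbol_mul s t (𝓕 f)).coeFn_toLp,
    (memLp_heatSymbol_mul s t (𝓕 g)).coeFn_toLp] with ξ h1 h2
  rw [h1, h2]
  simp only [heatSymbol, RCLike.inner_apply, map_mul, Complex.conj_ofReal]
  ring

theorem norm_inner_le_of_ae_eq_indicator {n : ℕ} {ω : Set (E n)}
    (g U : L2 n) {v : E n → ℂ} (hω : NullMeasurableSet ω volume)
    (hU : U =ᵐ[volume] ω.indicator v) {M : ℝ}
    (hM : 0 ≤ M) (hg : eLpNorm g 2 (volume.restrict ω) ≤ ENNReal.ofReal M) :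
    ‖inner ℂ g U‖ ≤ M * ‖U‖ := by
  have hmem : MemLp ((toMeasurable volume ω).indicator g) 2 volume :=
    (Lp.memLp g).indicator (measurableSet_toMeasurable _ _)
  have hae : toMeasurable volume ω =ᵐ[volume] ω := hω.toMeasurable_ae_eq
  have h1 : inner ℂ g U = inner ℂ hmem.toLp U := by
    rw [L2.inner_def, L2.inner_def]
    refine integral_congr_ae ?_
    filter_upwards [hmem.coeFn_toLp, hU, indicator_ae_eq_of_ae_eq_set (f := (g : E n → ℂ)) hae]
      with x h1 h2 h3
    rw [h1, h2, h3]
    by_cases hx : x ∈ ω <;> simp [hx]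
  rw [h1]
  refine (norm_inner_le_norm _ _).trans (mul_le_mul_of_nonneg_right ?_ (norm_nonneg _))
  rw [Lp.norm_toLp, eLpNorm_indicator_eq_eLpNorm_restrict (measurableSet_toMeasurable _ _),
    Measure.restrict_congr_set hae]
  exact ENNReal.toReal_le_of_le_ofReal hM hg

/-- Null-controllability implies a (weak) observability inequality. -/
theorem NullControllable.observability {n : ℕ} {s T : ℝ} {ω : Set (E n)} (hT : 0 < T)
    (hω : NullMeasurableSet ω volume) (h : NullControllable s T ω) :
    ∃ C : ℝ, 0 ≤ C ∧ ∀ (g : L2 n) (M : ℝ), 0 < M →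
      (∀ t ∈ Icc 0 T, eLpNorm (heatSemigroup s t g) 2 (volume.restrict ω) ≤ ENNReal.ofReal M) →
      ‖heatSemigroup s T g‖ ≤ C * M := by
  -- Uniform boundedness is applied to the functionals `⟪heatSemigroup s T g, ·⟫ / M` over all
  -- admissible pairs `(g, M)`. A control for `f₀` bounds them all at `f₀` by the `L¹`-in-time norm
  -- of the source, so no linear choice of controls is needed.
  let ι := {p : L2 n × ℝ // 0 < p.2 ∧ ∀ t ∈ Icc 0 T,
    eLpNorm (heatSemigroup s t p.1) 2 (volume.restrict ω) ≤ ENNReal.ofReal p.2}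
  let Φ : ι → L2 n →L[ℂ] ℂ := fun i =>
    ((i.1.2⁻¹ : ℝ) : ℂ) • innerSL ℂ (heatSemigroup s T i.1.1)
  obtain ⟨C, hC⟩ : ∃ C', ∀ i, ‖Φ i‖ ≤ C' := by
    refine banach_steinhaus fun f₀ => ?_
    obtain ⟨u, -, f, ⟨U, hU, hUω, hf⟩, hfT⟩ := h f₀
    obtain ⟨hint, hsol⟩ := hf T (right_mem_Icc.2 hT.le)
    have hUint : IntegrableOn (fun τ => ‖U τ‖) (Ioo 0 T) :=
      (hU.integrable (by norm_num)).norm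
    refine ⟨∫ τ in Ioo 0 T, ‖U τ‖, fun i => ?_⟩
    obtain ⟨⟨g, M⟩, hM, hg⟩ := i
    dsimp only at hM hg
    have h0 : heatSemigroup s T f₀ = -∫ τ in Ioo 0 T, heatSemigroup s (T - τ) (U τ) :=
      eq_neg_of_add_eq_zero_left (hsol.symm.trans hfT)
    have h1 : ‖inner ℂ (heatSemigroup s T g) f₀‖ ≤ M * ∫ τ in Ioo 0 T, ‖U τ‖ := by
      rw [inner_heatSemigroup, h0, inner_neg_right, norm_neg, ← integral_inner hint,
        ← integral_const_mul]
      refine (norm_integral_le_integral_norm _).trans ?_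
      refine integral_mono_ae (hint.const_inner g).norm (hUint.const_mul M) ?_
      filter_upwards [hUω, ae_restrict_mem measurableSet_Ioo] with τ hτ hτ'
      rw [← inner_heatSemigroup]
      exact norm_inner_le_of_ae_eq_indicator _ _ hω hτ hM.le
        (hg _ ⟨by linarith [hτ'.2], by linarith [hτ'.1]⟩)
    simp only [Φ, smul_apply, innerSL_apply_apply, smul_eq_mul, norm_mul,
      Complex.norm_real, norm_inv, Real.norm_eq_abs, abs_of_pos hM]
    rw [inv_mul_le_iff₀ hM]
    exact h1
  refine ⟨max C 0, le_max_right _ _, fun g M hM hg => ?_⟩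
  have h1 := hC ⟨(g, M), hM, hg⟩
  simp only [Φ, norm_smul, innerSL_apply_norm, 
      Complex.norm_real, norm_inv, Real.norm_eq_abs, abs_of_pos hM] at h1
  rw [inv_mul_le_iff₀ hM] at h1
  rw [mul_comm]
  exact h1.trans (mul_le_mul_of_nonneg_left (le_max_left _ _) hM.le)

end FracHeat

/-! ### Holomorphic expansion of the symbol, uniform in time. -/

namespace FracHeat

/-- The argument of `z ^ (s/2)` is at most `π/2` in absolute value, so its real part is nonnegative.
The bound does not depend on `τ`, which later grows like `ρ^s`. -/
theorem norm_exp_neg_mul_cpow_le_one {s τ : ℝ} (hs₀ : 0 < s) (hs₁ : s < 1) (hτ : 0 ≤ τ) (z : ℂ) :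
    ‖Complex.exp (-τ * z ^ ((s / 2 : ℝ) : ℂ))‖ ≤ 1 := by
  rw [Complex.norm_exp, Real.exp_le_one_iff]
  have h : 0 ≤ (z ^ ((s / 2 : ℝ) : ℂ)).re := by
    rcases eq_or_ne z 0 with rfl | hz
    · rw [Complex.zero_cpow (by exact_mod_cast (half_pos hs₀).ne')]; simp
    · rw [Complex.cpow_def_of_ne_zero hz, Complex.exp_re]
      refine mul_nonneg (Real.exp_nonneg _) (Real.cos_nonneg_of_mem_Icc ?_)
      have h1 := Complex.abs_arg_le_pi z
      rw [abs_le] at h1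
      have : (Complex.log z * ((s / 2 : ℝ) : ℂ)).im = z.arg * (s / 2) := by
        rw [Complex.im_mul_ofReal, Complex.log_im]
      rw [this]
      constructor <;> nlinarith [Real.pi_pos, h1.1, h1.2]
  have : (-(τ : ℂ) * z ^ ((s / 2 : ℝ) : ℂ)).re = -(τ * (z ^ ((s / 2 : ℝ) : ℂ)).re) := by
    rw [← Complex.ofReal_neg, Complex.re_ofReal_mul]; ring
  rw [this]
  nlinarith [mul_nonneg hτ h]

/-- Cauchy's estimates on the circle of radius `1/2` about `w = 1`. The variable is `w = exp v`
rather than `v` so that monomials become Gaussians in `ξ`. -/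
theorem exists_taylor_coeff {s τ : ℝ} (hs₀ : 0 < s) (hs₁ : s < 1) (hτ : 0 ≤ τ) :
    ∃ c : ℕ → ℂ, (∀ k, ‖c k‖ ≤ 2 ^ k) ∧ ∀ v : ℝ, v ≤ 1 → |Real.exp v - 1| ≤ 1 / 4 →
      HasSum (fun k => c k * ((Real.exp v - 1 : ℝ) : ℂ) ^ k)
        ((Real.exp (-(τ * (1 - v) ^ (s / 2))) : ℝ) : ℂ) := by
  set φ : ℂ → ℂ := fun w => Complex.exp (-τ * (1 - Complex.log w) ^ ((s / 2 : ℝ) : ℂ)) with hφ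
  have hd : DifferentiableOn ℂ φ (Metric.ball 1 1) := by
    intro w hw
    have hw1 : w ∈ Complex.slitPlane := Complex.ball_one_subset_slitPlane hw
    have hw2 : 1 - Complex.log w ∈ Complex.slitPlane := by
      -- On the disc `‖w‖ < 2 < e`, so `1 - log w` has positive real part.
      left
      rw [Complex.sub_re, Complex.one_re, Complex.log_re]
      have h1 : ‖w‖ < 2 := by
        have := norm_le_norm_add_norm_sub' w 1
        rw [mem_ball_iff_norm] at hw
        rw [norm_one] at this
        linarith
      have h2 : Real.log ‖w‖ < 1 := by
        rw [Real.log_lt_iff_lt_exp (norm_pos_iff.2 (Complex.slitPlane_ne_zero hw1))]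
        exact h1.trans (by linarith [Real.exp_one_gt_d9])
      linarith
    refine DifferentiableAt.differentiableWithinAt ?_
    refine DifferentiableAt.cexp ?_
    refine DifferentiableAt.const_mul ?_ _
    exact ((Complex.differentiableAt_log hw1).const_sub 1).cpow_const hw2
  refine ⟨fun k => (k.factorial : ℂ)⁻¹ * iteratedDeriv k φ 1, fun k => ?_, fun v hv hv4 => ?_⟩
  · have h1 := Complex.norm_iteratedDeriv_le_of_forall_mem_sphere_norm_le (f := φ) (c := 1)
      (R := 1 / 2) (C := 1) k (by norm_num)
      (hd.diffContOnCl_ball (Metric.closedBall_subset_ball (by norm_num)))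
      (fun z _ => norm_exp_neg_mul_cpow_le_one hs₀ hs₁ hτ _)
    rw [norm_mul, norm_inv, Complex.norm_natCast]
    have hk : (0 : ℝ) < k.factorial := by exact_mod_cast k.factorial_pos
    rw [inv_mul_le_iff₀ hk]
    simpa using h1
  · have hmem : ((Real.exp v : ℝ) : ℂ) ∈ Metric.ball (1 : ℂ) 1 := by
      rw [mem_ball_iff_norm, ← Complex.ofReal_one, ← Complex.ofReal_sub, Complex.norm_real,
        Real.norm_eq_abs]
      linarith
    have h1 := Complex.hasSum_taylorSeries_on_ball hd hmem
    have h2 : φ ((Real.exp v : ℝ) : ℂ) = ((Real.exp (-(τ * (1 - v) ^ (s / 2))) : ℝ) : ℂ) := by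
      rw [hφ]
      simp only
      rw [← Complex.ofReal_log (Real.exp_pos v).le, Real.log_exp, ← Complex.ofReal_one,
        ← Complex.ofReal_sub, ← Complex.ofReal_cpow (by linarith)]
      push_cast
      ring_nf
    rw [h2] at h1
    refine h1.congr_fun fun k => ?_
    push_cast
    simp only [smul_eq_mul]
    ring

/-- Truncated Taylor expansion of the symbol, as a polynomial in `exp v`. -/
theorem exists_poly_approx {s τ : ℝ} (hs₀ : 0 < s) (hs₁ : s < 1) (hτ : 0 ≤ τ) :
    ∃ c : ℕ → ℂ, (∀ k, ‖c k‖ ≤ 2 ^ k) ∧ ∀ (N : ℕ) (v : ℝ), v ≤ 1 →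
      (|Real.exp v - 1| ≤ 1 / 4 →
        ‖((Real.exp (-(τ * (1 - v) ^ (s / 2))) : ℝ) : ℂ) -
          ∑ k ∈ Finset.range N, c k * ((Real.exp v - 1 : ℝ) : ℂ) ^ k‖ ≤ 2 * (1 / 2) ^ N) ∧
      ‖((Real.exp (-(τ * (1 - v) ^ (s / 2))) : ℝ) : ℂ) -
          ∑ k ∈ Finset.range N, c k * ((Real.exp v - 1 : ℝ) : ℂ) ^ k‖ ≤ 2 * 4 ^ N := by
  obtain ⟨c, hc, hsum⟩ := exists_taylor_coeff hs₀ hs₁ hτ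
  refine ⟨c, hc, fun N v hv => ⟨fun hv4 => ?_, ?_⟩⟩
  · have h := hsum v hv hv4
    rw [← h.tsum_eq, ← h.summable.sum_add_tsum_nat_add N, add_sub_cancel_left]
    have hg : HasSum (fun k : ℕ => (1 / 2 : ℝ) ^ N * (1 / 2) ^ k) ((1 / 2) ^ N * 2) :=
      hasSum_geometric_two.mul_left _
    rw [mul_comm]
    refine tsum_of_norm_bounded hg fun k => ?_
    rw [norm_mul, norm_pow, Complex.norm_real, Real.norm_eq_abs, ← pow_add, add_comm N k]
    calc _ ≤ 2 ^ (k + N) * (1 / 4 : ℝ) ^ (k + N) :=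
          mul_le_mul (hc _) (pow_le_pow_left₀ (abs_nonneg _) hv4 _) (by positivity) (by positivity)
      _ = _ := by rw [← mul_pow]; norm_num
  · have h1 : ‖((Real.exp (-(τ * (1 - v) ^ (s / 2))) : ℝ) : ℂ)‖ ≤ 4 ^ N := by
      rw [Complex.norm_real, Real.norm_eq_abs, Real.abs_exp]
      refine le_trans (Real.exp_le_one_iff.2 ?_) (one_le_pow₀ (by norm_num))
      have : 0 ≤ (1 - v) ^ (s / 2) := Real.rpow_nonneg (by linarith) _
      nlinarith [mul_nonneg hτ this]
    -- Outside the convergence region only `v ≤ 1` is used: `e - 1 < 2`, so the `k`-th term is at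
    -- most `4^k`.
    have hv2 : |Real.exp v - 1| ≤ 2 := by
      have h3 : Real.exp v ≤ Real.exp 1 := Real.exp_le_exp.2 hv
      rw [abs_le]
      constructor <;> linarith [Real.exp_pos v, Real.exp_one_lt_d9]
    have h2 : ‖∑ k ∈ Finset.range N, c k * ((Real.exp v - 1 : ℝ) : ℂ) ^ k‖ ≤ 4 ^ N := by
      refine (norm_sum_le _ _).trans ?_
      calc _ ≤ ∑ k ∈ Finset.range N, (4 : ℝ) ^ k := by
            refine Finset.sum_le_sum fun k _ => ?_
            rw [norm_mul, norm_pow, Complex.norm_real, Real.norm_eq_abs]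
            calc _ ≤ 2 ^ k * (2 : ℝ) ^ k :=
                  mul_le_mul (hc _) (pow_le_pow_left₀ (abs_nonneg _) hv2 _) (by positivity)
                    (by positivity)
              _ = _ := by rw [← mul_pow]; norm_num
        _ ≤ 4 ^ N := by
            rw [geom_sum_eq (by norm_num)]
            have : (1 : ℝ) ≤ 4 ^ N := one_le_pow₀ (by norm_num)
            linarith
    linarith [norm_sub_le (((Real.exp (-(τ * (1 - v) ^ (s / 2))) : ℝ) : ℂ))
      (∑ k ∈ Finset.range N, c k * ((Real.exp v - 1 : ℝ) : ℂ) ^ k)]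

end FracHeat

/-! ### Coherent states under Gaussian multipliers. -/

namespace FracHeat

/-- The Fourier transform of a coherent state at position `x₀` and frequency `ξ₀`. -/
noncomputable def packet {n : ℕ} (ρ : ℝ) (ξ₀ x₀ ξ : E n) : ℂ :=
  Complex.exp (((-(Real.pi / ρ * ‖ξ - ξ₀‖ ^ 2) : ℝ) : ℂ) +
    ((-(2 * Real.pi * inner ℝ ξ x₀) : ℝ) : ℂ) * Complex.I)

theorem norm_packet {n : ℕ} (ρ : ℝ) (ξ₀ x₀ ξ : E n) :
    ‖packet ρ ξ₀ x₀ ξ‖ = Real.exp (-(Real.pi / ρ * ‖ξ - ξ₀‖ ^ 2)) := by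
  rw [packet, Complex.norm_exp, Complex.add_re, Complex.ofReal_re, Complex.re_ofReal_mul,
    Complex.I_re, mul_zero, add_zero]

theorem continuous_packet {n : ℕ} (ρ : ℝ) (ξ₀ x₀ : E n) : Continuous (packet ρ ξ₀ x₀) := by
  unfold packet
  fun_prop

theorem integrable_gaussian {n : ℕ} {β : ℝ} (hβ : 0 < β) (a : E n) :
    Integrable (fun x : E n => Real.exp (-(β * ‖x - a‖ ^ 2))) volume := by
  have h := (GaussianFourier.integrable_cexp_neg_mul_sq_norm_add (V := E n) (b := (β : ℂ))
    (by simpa using hβ) 0 0).norm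
  refine (h.comp_sub_right a).congr (.of_forall fun x => ?_)
  simp only [Complex.norm_exp]
  congr 1
  rw [zero_mul, add_zero, ← Complex.ofReal_neg, Complex.re_ofReal_mul, ← Complex.ofReal_pow,
    Complex.ofReal_re]
  ring

theorem eLpNorm_le_of_norm_le_gaussian {n : ℕ} {F : Type*} [NormedAddCommGroup F] {μ : Measure (E n)}
    (hμ : μ ≤ volume) {f : E n → F} {A β : ℝ} (hA : 0 ≤ A)
    (hβ : 0 < β) (a : E n) (hf : ∀ᵐ x ∂μ, ‖f x‖ ≤ A * Real.exp (-(β * ‖x - a‖ ^ 2))) :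
    eLpNorm f 2 μ ≤ ENNReal.ofReal (A * (Real.pi / (2 * β)) ^ ((n : ℝ) / 4)) := by
  refine (eLpNorm_mono_ae_real hf).trans ((eLpNorm_mono_measure _ hμ).trans ?_)
  rw [eLpNorm_eq_lintegral_rpow_enorm_toReal two_ne_zero ENNReal.ofNat_ne_top]
  have h1 : ∀ x : E n, ‖A * Real.exp (-(β * ‖x - a‖ ^ 2))‖ₑ ^ (ENNReal.toReal 2) =
      ENNReal.ofReal (A ^ 2 * Real.exp (-(2 * β * ‖x - a‖ ^ 2))) := fun x => by
    rw [Real.enorm_of_nonneg (by positivity), ENNReal.toReal_ofNat,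
      ENNReal.ofReal_rpow_of_nonneg (by positivity) (by norm_num)]
    congr 1
    rw [Real.rpow_two, mul_pow, ← Real.exp_nat_mul]
    congr 2
    push_cast
    ring
  simp_rw [h1]
  rw [← ofReal_integral_eq_lintegral_ofReal
    ((integrable_gaussian (by positivity) a).const_mul _) (.of_forall fun x => by positivity),
    integral_const_mul, integral_sub_right_eq_self (fun x : E n => Real.exp (-(2 * β * ‖x‖ ^ 2))) a]
  have h2 := GaussianFourier.integral_rexp_neg_mul_sq_norm (V := E n) (b := 2 * β) (by positivity)
  simp only [finrank_euclideanSpace, Fintype.card_fin, neg_mul] at h2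
  rw [show (∫ x : E n, Real.exp (-(2 * β * ‖x‖ ^ 2))) = (Real.pi / (2 * β)) ^ ((n : ℝ) / 2) from by
    rw [← h2], ENNReal.toReal_ofNat,
    ENNReal.ofReal_rpow_of_nonneg (by positivity) (by norm_num),
    Real.mul_rpow (by positivity) (by positivity), ← Real.rpow_mul (by positivity),
    ← Real.rpow_natCast, ← Real.rpow_mul hA]
  refine ENNReal.ofReal_le_ofReal (le_of_eq ?_)
  norm_num
  left
  congr 1
  ring

theorem integrable_packet {n : ℕ} {ρ : ℝ} (hρ : 0 < ρ) (ξ₀ x₀ : E n) :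
    Integrable (packet ρ ξ₀ x₀) volume :=
  (integrable_gaussian (by positivity : 0 < Real.pi / ρ) ξ₀).mono'
    (continuous_packet _ _ _).aestronglyMeasurable (.of_forall fun ξ => (norm_packet _ _ _ _).le)

theorem memLp_packet {n : ℕ} {ρ : ℝ} (hρ : 0 < ρ) (ξ₀ x₀ : E n) :
    MemLp (packet ρ ξ₀ x₀) 2 volume :=
  ⟨(continuous_packet _ _ _).aestronglyMeasurable,
    (eLpNorm_le_of_norm_le_gaussian le_rfl zero_le_one (by positivity : 0 < Real.pi / ρ) ξ₀
      (.of_forall fun ξ => by rw [norm_packet, one_mul])).trans_lt ENNReal.ofReal_lt_top⟩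

/-- Completing the square: `b` is the total quadratic coefficient and `κ • ξ₀` the shifted centre in
frequency. The spatial centre remains `x₀`. -/
theorem fourierInv_integrand_eq {n : ℕ} {ρ : ℝ} (hρ : 0 < ρ) {ξ₀ : E n} (hξ₀ : ‖ξ₀‖ = ρ)
    (x₀ x ξ : E n) (j : ℕ) {b κ : ℝ} (hb : b = Real.pi / ρ + j / ρ ^ 2) (hκ : κ = Real.pi / (ρ * b)) :
    Complex.exp (((2 * Real.pi * inner ℝ ξ x : ℝ) : ℂ) * Complex.I) •
      (((Real.exp (1 - ‖ξ‖ ^ 2 / ρ ^ 2) : ℝ) : ℂ) ^ j * packet ρ ξ₀ x₀ ξ) =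
    Complex.exp (((j - Real.pi * ρ + Real.pi ^ 2 / b : ℝ) : ℂ) +
      ((2 * Real.pi * inner ℝ (x - x₀) (κ • ξ₀) : ℝ) : ℂ) * Complex.I) *
    Complex.exp (-(b : ℂ) * ‖ξ - κ • ξ₀‖ ^ 2 +
      (2 * Real.pi * Complex.I) * (inner ℝ (x - x₀) (ξ - κ • ξ₀) : ℝ)) := by
  have hb0 : 0 < b := by rw [hb]; positivity
  have hre : (j : ℝ) * (1 - ‖ξ‖ ^ 2 / ρ ^ 2) - Real.pi / ρ * ‖ξ - ξ₀‖ ^ 2 =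
      j - Real.pi * ρ + Real.pi ^ 2 / b - b * ‖ξ - κ • ξ₀‖ ^ 2 := by
    rw [norm_sub_sq_real, norm_sub_sq_real, inner_smul_right, norm_smul, hξ₀, mul_pow,
      Real.norm_eq_abs, sq_abs]
    have h1 : b * κ = Real.pi / ρ := by rw [hκ]; field_simp
    have h2 : b * κ ^ 2 * ρ ^ 2 = Real.pi ^ 2 / b := by rw [hκ]; field_simp
    have h3 : Real.pi / ρ * ρ ^ 2 = Real.pi * ρ := by field_simp
    linear_combination (2 * inner ℝ ξ ξ₀) * (-h1) + h2 - h3 + ‖ξ‖ ^ 2 * hb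
  have him : 2 * Real.pi * inner ℝ ξ x - 2 * Real.pi * inner ℝ ξ x₀ =
      2 * Real.pi * inner ℝ (x - x₀) (κ • ξ₀) + 2 * Real.pi * inner ℝ (x - x₀) (ξ - κ • ξ₀) := by
    rw [← mul_add, ← inner_add_right, add_sub_cancel, inner_sub_left, real_inner_comm x,
      real_inner_comm x₀]
    ring
  have hre' := congrArg (fun r : ℝ => (r : ℂ)) hre
  have him' := congrArg (fun r : ℝ => (r : ℂ)) him
  rw [Complex.ofReal_exp, ← Complex.exp_nat_mul, packet, smul_eq_mul, ← Complex.exp_add,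
    ← Complex.exp_add, ← Complex.exp_add]
  congr 1
  push_cast at hre' him' ⊢
  linear_combination hre' + Complex.I * him'

/-- The restriction on `j` keeps `π / b` between `ρ / 2` and `ρ`, so the multiplier changes the
spatial width by a bounded factor only. -/
theorem norm_fourierInv_le {n : ℕ} {ρ : ℝ} (hρ : 0 < ρ) {ξ₀ : E n} (hξ₀ : ‖ξ₀‖ = ρ)
    (x₀ x : E n) {j : ℕ} (hj : j ≤ Real.pi * ρ) :
    ‖𝓕⁻ (fun ξ => ((Real.exp (1 - ‖ξ‖ ^ 2 / ρ ^ 2) : ℝ) : ℂ) ^ j * packet ρ ξ₀ x₀ ξ) x‖ ≤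
      ρ ^ ((n : ℝ) / 2) * Real.exp j * Real.exp (-(Real.pi * ρ / 2 * ‖x - x₀‖ ^ 2)) := by
  obtain ⟨b, hb⟩ : ∃ b : ℝ, b = Real.pi / ρ + j / ρ ^ 2 := ⟨_, rfl⟩
  obtain ⟨κ, hκ⟩ : ∃ κ : ℝ, κ = Real.pi / (ρ * b) := ⟨_, rfl⟩
  have hb0 : 0 < b := by rw [hb]; positivity
  have hb1 : Real.pi / b ≤ ρ := by
    rw [div_le_iff₀ hb0, hb, mul_add, mul_div_cancel₀ _ hρ.ne']
    have : 0 ≤ ρ * (j / ρ ^ 2) := by positivity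
    linarith
  have hb2 : ρ / 2 ≤ Real.pi / b := by
    rw [le_div_iff₀ hb0, hb]
    have : ρ / 2 * (Real.pi / ρ + j / ρ ^ 2) = Real.pi / 2 + j / ρ / 2 := by field_simp
    rw [this]
    have : (j : ℝ) / ρ ≤ Real.pi := by rwa [div_le_iff₀ hρ]
    linarith
  rw [Real.fourierInv_eq']
  simp_rw [fun ξ => fourierInv_integrand_eq hρ hξ₀ x₀ x ξ j hb hκ]
  rw [integral_const_mul, integral_sub_right_eq_self (fun ξ : E n =>
    Complex.exp (-(b : ℂ) * ‖ξ‖ ^ 2 + (2 * Real.pi * Complex.I) * (inner ℝ (x - x₀) ξ : ℝ))),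
    GaussianFourier.integral_cexp_neg_mul_sq_norm_add (by simpa using hb0), norm_mul, norm_mul,
    Complex.norm_exp, Complex.norm_exp]
  have h1 : ‖((Real.pi : ℂ) / b) ^ ((Module.finrank ℝ (E n) : ℂ) / 2)‖ ≤ ρ ^ ((n : ℝ) / 2) := by
    rw [← Complex.ofReal_div, Complex.norm_cpow_eq_rpow_re_of_pos (by positivity)]
    simp only [finrank_euclideanSpace, Fintype.card_fin]
    rw [show ((n : ℂ) / 2).re = (n : ℝ) / 2 by norm_num]
    exact Real.rpow_le_rpow (by positivity) hb1 (by positivity)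
  have h2 : ((2 * Real.pi * Complex.I) ^ 2 * (‖x - x₀‖ : ℂ) ^ 2 / (4 * (b : ℂ))).re =
      -(Real.pi * (Real.pi / b) * ‖x - x₀‖ ^ 2) := by
    have : (2 * Real.pi * Complex.I) ^ 2 * (‖x - x₀‖ : ℂ) ^ 2 / (4 * (b : ℂ)) =
        ((-(Real.pi * (Real.pi / b) * ‖x - x₀‖ ^ 2) : ℝ) : ℂ) := by
      have hb' : (b : ℂ) ≠ 0 := by exact_mod_cast hb0.ne'
      push_cast
      rw [mul_pow, Complex.I_sq]
      field_simp
      ring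
    rw [this, Complex.ofReal_re]
  rw [h2]
  have h3 : (((j - Real.pi * ρ + Real.pi ^ 2 / b : ℝ) : ℂ) +
      ((2 * Real.pi * inner ℝ (x - x₀) (κ • ξ₀) : ℝ) : ℂ) * Complex.I).re ≤ j := by
    rw [Complex.add_re, Complex.ofReal_re, Complex.re_ofReal_mul, Complex.I_re, mul_zero, add_zero]
    have : Real.pi ^ 2 / b ≤ Real.pi * ρ := by
      rw [pow_two, mul_div_assoc]
      exact mul_le_mul_of_nonneg_left hb1 Real.pi_pos.le
    linarith
  have h4 : -(Real.pi * (Real.pi / b) * ‖x - x₀‖ ^ 2) ≤ -(Real.pi * ρ / 2 * ‖x - x₀‖ ^ 2) := by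
    have : Real.pi * ρ / 2 ≤ Real.pi * (Real.pi / b) := by
      rw [mul_div_assoc]; exact mul_le_mul_of_nonneg_left hb2 Real.pi_pos.le
    nlinarith [sq_nonneg ‖x - x₀‖]
  calc _ ≤ Real.exp j * (ρ ^ ((n : ℝ) / 2) * Real.exp (-(Real.pi * ρ / 2 * ‖x - x₀‖ ^ 2))) := by
        gcongr
    _ = _ := by ring

/-- The truncated symbol applied to a coherent state. -/
noncomputable def truncPacket {n : ℕ} (c : ℕ → ℂ) (N : ℕ) (ρ : ℝ) (ξ₀ x₀ ξ : E n) : ℂ :=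
  (∑ k ∈ Finset.range N, c k * ((Real.exp (1 - ‖ξ‖ ^ 2 / ρ ^ 2) - 1 : ℝ) : ℂ) ^ k) *
    packet ρ ξ₀ x₀ ξ

theorem continuous_truncPacket {n : ℕ} (c : ℕ → ℂ) (N : ℕ) (ρ : ℝ) (ξ₀ x₀ : E n) :
    Continuous (truncPacket c N ρ ξ₀ x₀) := by
  unfold truncPacket
  have := continuous_packet ρ ξ₀ x₀
  fun_prop

theorem integrable_pow_mul_packet {n : ℕ} {ρ : ℝ} (hρ : 0 < ρ) (ξ₀ x₀ : E n) (j : ℕ) :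
    Integrable (fun ξ => ((Real.exp (1 - ‖ξ‖ ^ 2 / ρ ^ 2) : ℝ) : ℂ) ^ j * packet ρ ξ₀ x₀ ξ) := by
  refine (integrable_packet hρ ξ₀ x₀).bdd_mul (c := Real.exp 1 ^ j) ?_ (.of_forall fun ξ => ?_)
  · exact Continuous.aestronglyMeasurable (by fun_prop)
  · rw [norm_pow, Complex.norm_real, Real.norm_eq_abs, Real.abs_exp]
    have : 0 ≤ ‖ξ‖ ^ 2 / ρ ^ 2 := by positivity
    gcongr
    linarith

theorem truncPacket_eq_sum {n : ℕ} (c : ℕ → ℂ) (N : ℕ) (ρ : ℝ) (ξ₀ x₀ ξ : E n) :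
    truncPacket c N ρ ξ₀ x₀ ξ = ∑ k ∈ Finset.range N, ∑ j ∈ Finset.range (k + 1),
      (c k * ((-1) ^ (k - j) * (k.choose j : ℂ))) *
        (((Real.exp (1 - ‖ξ‖ ^ 2 / ρ ^ 2) : ℝ) : ℂ) ^ j * packet ρ ξ₀ x₀ ξ) := by
  rw [truncPacket, Finset.sum_mul]
  refine Finset.sum_congr rfl fun k _ => ?_
  rw [Complex.ofReal_sub, Complex.ofReal_one, sub_eq_add_neg, add_pow, Finset.mul_sum,
    Finset.sum_mul]
  exact Finset.sum_congr rfl fun j _ => by ring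

theorem integrable_truncPacket {n : ℕ} (c : ℕ → ℂ) (N : ℕ) {ρ : ℝ} (hρ : 0 < ρ) (ξ₀ x₀ : E n) :
    Integrable (truncPacket c N ρ ξ₀ x₀) volume := by
  rw [funext (truncPacket_eq_sum c N ρ ξ₀ x₀)]
  exact integrable_finsetSum _ fun k _ => integrable_finsetSum _ fun j _ =>
    (integrable_pow_mul_packet hρ ξ₀ x₀ j).const_mul _

/-- Each `(w - 1)^k` is expanded by the binomial formula. As `e < 3`, the `k`-th term costs at most
`2^k (3 + 1)^k = 8^k`. -/
theorem norm_fourierInv_truncPacket_le {n : ℕ} {c : ℕ → ℂ} (hc : ∀ k, ‖c k‖ ≤ 2 ^ k) {N : ℕ}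
    {ρ : ℝ} (hρ : 0 < ρ) (hN : N ≤ Real.pi * ρ) {ξ₀ : E n} (hξ₀ : ‖ξ₀‖ = ρ) (x₀ x : E n) :
    ‖𝓕⁻ (truncPacket c N ρ ξ₀ x₀) x‖ ≤
      8 ^ N * ρ ^ ((n : ℝ) / 2) * Real.exp (-(Real.pi * ρ / 2 * ‖x - x₀‖ ^ 2)) := by
  set D := ρ ^ ((n : ℝ) / 2) * Real.exp (-(Real.pi * ρ / 2 * ‖x - x₀‖ ^ 2)) with hD
  have hD0 : 0 ≤ D := by positivity
  set G : ℕ → E n → ℂ := fun j ξ =>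
    ((Real.exp (1 - ‖ξ‖ ^ 2 / ρ ^ 2) : ℝ) : ℂ) ^ j * packet ρ ξ₀ x₀ ξ with hG
  have hGi : ∀ j, Integrable (fun ξ =>
      Complex.exp (((2 * Real.pi * inner ℝ ξ x : ℝ) : ℂ) * Complex.I) • G j ξ) := fun j => by
    refine (integrable_pow_mul_packet hρ ξ₀ x₀ j).bdd_mul (c := 1) ?_ (.of_forall fun ξ => ?_)
    · exact Continuous.aestronglyMeasurable (by fun_prop)
    · rw [Complex.norm_exp_ofReal_mul_I]
  have hlin : 𝓕⁻ (truncPacket c N ρ ξ₀ x₀) x = ∑ k ∈ Finset.range N, ∑ j ∈ Finset.range (k + 1),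
      (c k * ((-1) ^ (k - j) * (k.choose j : ℂ))) * 𝓕⁻ (G j) x := by
    have hsum : ∀ ξ, Complex.exp (((2 * Real.pi * inner ℝ ξ x : ℝ) : ℂ) * Complex.I) •
        truncPacket c N ρ ξ₀ x₀ ξ = ∑ k ∈ Finset.range N, ∑ j ∈ Finset.range (k + 1),
        (c k * ((-1) ^ (k - j) * (k.choose j : ℂ))) *
          (Complex.exp (((2 * Real.pi * inner ℝ ξ x : ℝ) : ℂ) * Complex.I) • G j ξ) := fun ξ => by
      rw [truncPacket_eq_sum, Finset.smul_sum]
      refine Finset.sum_congr rfl fun k _ => ?_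
      rw [Finset.smul_sum]
      exact Finset.sum_congr rfl fun j _ => by simp only [hG, smul_eq_mul]; ring
    simp_rw [Real.fourierInv_eq', hsum]
    rw [integral_finsetSum _ fun k _ => integrable_finsetSum _ fun j _ => (hGi j).const_mul _]
    refine Finset.sum_congr rfl fun k _ => ?_
    rw [integral_finsetSum _ fun j _ => (hGi j).const_mul _]
    exact Finset.sum_congr rfl fun j _ => integral_const_mul _ _
  rw [hlin]
  have hterm : ∀ k ∈ Finset.range N, ‖∑ j ∈ Finset.range (k + 1),
      (c k * ((-1) ^ (k - j) * (k.choose j : ℂ))) * 𝓕⁻ (G j) x‖ ≤ 8 ^ k * D := by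
    intro k hk
    refine (norm_sum_le _ _).trans ?_
    calc _ ≤ ∑ j ∈ Finset.range (k + 1), 2 ^ k * D * (3 ^ j * 1 ^ (k - j) * (k.choose j : ℝ)) := by
          refine Finset.sum_le_sum fun j hj => ?_
          have hjN : (j : ℝ) ≤ Real.pi * ρ := by
            refine le_trans ?_ hN
            have := Finset.mem_range.1 hk
            have := Finset.mem_range.1 hj
            exact_mod_cast (by omega : j ≤ N)
          have h1 := norm_fourierInv_le hρ hξ₀ x₀ x hjN
          have h2 : Real.exp j ≤ 3 ^ j := by
            rw [← Real.exp_one_pow]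
            exact pow_le_pow_left₀ (Real.exp_pos _).le (by linarith [Real.exp_one_lt_d9]) _
          rw [norm_mul, norm_mul, norm_mul, norm_pow, norm_neg, norm_one, one_pow, one_mul,
            Complex.norm_natCast]
          calc _ ≤ 2 ^ k * (k.choose j : ℝ) * (ρ ^ ((n : ℝ) / 2) * 3 ^ j *
                Real.exp (-(Real.pi * ρ / 2 * ‖x - x₀‖ ^ 2))) := by
                refine mul_le_mul (by gcongr; exact hc k) (h1.trans ?_) (norm_nonneg _)
                  (by positivity)
                gcongr
            _ = _ := by rw [hD]; ring
      _ = _ := by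
          rw [← Finset.mul_sum, ← add_pow, show (8 : ℝ) = 2 * (3 + 1) by norm_num, mul_pow]
          ring
  refine (norm_sum_le _ _).trans ((Finset.sum_le_sum hterm).trans ?_)
  rw [← Finset.sum_mul, mul_assoc]
  refine mul_le_mul_of_nonneg_right ?_ hD0
  rw [geom_sum_eq (by norm_num)]
  have : (1 : ℝ) ≤ 8 ^ N := one_le_pow₀ (by norm_num)
  linarith

end FracHeat

/-! ### Concentration and lower bound for evolved coherent states. -/

namespace FracHeat

theorem heatSymbol_eq {n : ℕ} {s t ρ : ℝ} (ht : 0 ≤ t) (hρ : 0 < ρ) (ξ : E n) :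
    heatSymbol s t ξ = ((Real.exp (-(t * (2 * Real.pi * ρ) ^ s *
      (1 - (1 - ‖ξ‖ ^ 2 / ρ ^ 2)) ^ (s / 2))) : ℝ) : ℂ) := by
  rw [heatSymbol, max_eq_left ht, sub_sub_cancel, ← div_pow, ← Real.rpow_natCast (‖ξ‖ / ρ) 2,
    ← Real.rpow_mul (by positivity), mul_assoc t,
    show ((2 : ℕ) : ℝ) * (s / 2) = s by push_cast; ring,
    ← Real.mul_rpow (by positivity) (by positivity)]
  rw [show 2 * Real.pi * ρ * (‖ξ‖ / ρ) = 2 * Real.pi * ‖ξ‖ by field_simp]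

/-- The radius `ρ / 17` works because `(18/17)² - 1 < 1/8`, and then `|e^v - 1| ≤ 2 |v|`. -/
theorem abs_exp_sub_one_le_of_near {n : ℕ} {ρ : ℝ} (hρ : 0 < ρ) {ξ₀ ξ : E n} (hξ₀ : ‖ξ₀‖ = ρ)
    (h : ‖ξ - ξ₀‖ ≤ ρ / 17) : |Real.exp (1 - ‖ξ‖ ^ 2 / ρ ^ 2) - 1| ≤ 1 / 4 := by
  have h1 : |‖ξ‖ - ρ| ≤ ρ / 17 := by rw [← hξ₀] at h ⊢; exact (abs_norm_sub_norm_le _ _).trans h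
  rw [abs_le] at h1
  have h2 : |1 - ‖ξ‖ ^ 2 / ρ ^ 2| ≤ 1 / 8 := by
    have : 1 - ‖ξ‖ ^ 2 / ρ ^ 2 = (ρ ^ 2 - ‖ξ‖ ^ 2) / ρ ^ 2 := by field_simp
    rw [this, abs_div, abs_of_pos (by positivity : 0 < ρ ^ 2), div_le_iff₀ (by positivity), abs_le]
    constructor <;> nlinarith [h1.1, h1.2, norm_nonneg ξ]
  have := Real.abs_exp_sub_one_le (h2.trans (by norm_num))
  linarith

theorem norm_remainder_le {n : ℕ} {s t ρ : ℝ} (ht : 0 ≤ t) (hρ : 0 < ρ) {ξ₀ : E n}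
    (hξ₀ : ‖ξ₀‖ = ρ) (x₀ : E n) {c : ℕ → ℂ} (hc : ∀ (N : ℕ) (v : ℝ), v ≤ 1 →
      (|Real.exp v - 1| ≤ 1 / 4 →
        ‖((Real.exp (-(t * (2 * Real.pi * ρ) ^ s * (1 - v) ^ (s / 2))) : ℝ) : ℂ) -
          ∑ k ∈ Finset.range N, c k * ((Real.exp v - 1 : ℝ) : ℂ) ^ k‖ ≤ 2 * (1 / 2) ^ N) ∧
      ‖((Real.exp (-(t * (2 * Real.pi * ρ) ^ s * (1 - v) ^ (s / 2))) : ℝ) : ℂ) -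
          ∑ k ∈ Finset.range N, c k * ((Real.exp v - 1 : ℝ) : ℂ) ^ k‖ ≤ 2 * 4 ^ N) (N : ℕ)
    (ξ : E n) :
    ‖heatSymbol s t ξ * packet ρ ξ₀ x₀ ξ - truncPacket c N ρ ξ₀ x₀ ξ‖ ≤
      (2 * (1 / 2) ^ N + 2 * 4 ^ N * Real.exp (-(Real.pi / 578 * ρ))) *
        Real.exp (-(Real.pi / (2 * ρ) * ‖ξ - ξ₀‖ ^ 2)) := by
  obtain ⟨h1, h2⟩ := hc N (1 - ‖ξ‖ ^ 2 / ρ ^ 2) (by linarith [show 0 ≤ ‖ξ‖ ^ 2 / ρ ^ 2 by positivity])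
  rw [truncPacket, heatSymbol_eq ht hρ, ← sub_mul, norm_mul, norm_packet]
  -- One half of the Gaussian exponent is kept for integrability; the other absorbs `4^N` beyond
  -- distance `ρ / 17`, whence `578 = 2 · 17²`.
  have hhalf : Real.exp (-(Real.pi / ρ * ‖ξ - ξ₀‖ ^ 2)) =
      Real.exp (-(Real.pi / (2 * ρ) * ‖ξ - ξ₀‖ ^ 2)) *
        Real.exp (-(Real.pi / (2 * ρ) * ‖ξ - ξ₀‖ ^ 2)) := by
    rw [← Real.exp_add]; congr 1; field_simp; ring
  have hle1 : Real.exp (-(Real.pi / (2 * ρ) * ‖ξ - ξ₀‖ ^ 2)) ≤ 1 := by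
    rw [Real.exp_le_one_iff]
    have : 0 ≤ Real.pi / (2 * ρ) * ‖ξ - ξ₀‖ ^ 2 := by positivity
    linarith
  rw [hhalf, ← mul_assoc]
  refine mul_le_mul_of_nonneg_right ?_ (Real.exp_nonneg _)
  rcases le_or_gt ‖ξ - ξ₀‖ (ρ / 17) with hξ | hξ
  · calc _ ≤ 2 * (1 / 2 : ℝ) ^ N * 1 := by
          gcongr
          exact h1 (abs_exp_sub_one_le_of_near hρ hξ₀ hξ)
      _ ≤ _ := by rw [mul_one]; exact le_add_of_nonneg_right (by positivity)
  · calc _ ≤ 2 * (4 : ℝ) ^ N * Real.exp (-(Real.pi / 578 * ρ)) := by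
          refine mul_le_mul h2 (Real.exp_le_exp.2 (neg_le_neg ?_)) (Real.exp_nonneg _)
            (by positivity)
          calc Real.pi / 578 * ρ = Real.pi / (2 * ρ) * (ρ / 17) ^ 2 := by field_simp; ring
            _ ≤ _ := by gcongr
      _ ≤ _ := le_add_of_nonneg_left (by positivity)

/-- Coherent states stay concentrated near their centre under the fractional heat flow. -/
theorem eLpNorm_heatSemigroup_packet_le {n : ℕ} {s t ρ L : ℝ} (hs₀ : 0 < s) (hs₁ : s < 1)
    (ht : 0 ≤ t) (hρ : 0 < ρ) (hL : 0 ≤ L) {ξ₀ : E n} (hξ₀ : ‖ξ₀‖ = ρ) (x₀ : E n) {N : ℕ}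
    (hN : N ≤ Real.pi * ρ) (ω : Set (E n)) :
    eLpNorm (heatSemigroup s t (𝓕⁻ (memLp_packet hρ ξ₀ x₀).toLp)) 2 (volume.restrict ω) ≤
      ENNReal.ofReal ((2 * (1 / 2) ^ N + 2 * 4 ^ N * Real.exp (-(Real.pi / 578 * ρ))) *
          ρ ^ ((n : ℝ) / 4) +
        (8 ^ N * ρ ^ ((n : ℝ) / 2) * (volume (ω ∩ Metric.ball x₀ L)).toReal ^ (1 / 2 : ℝ) +
        8 ^ N * ρ ^ ((n : ℝ) / 2) * Real.exp (-(Real.pi * ρ / 4 * L ^ 2)) *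
          (2 / ρ) ^ ((n : ℝ) / 4))) := by
  obtain ⟨c, hc, happ⟩ := exists_poly_approx hs₀ hs₁
    (by positivity : 0 ≤ t * (2 * Real.pi * ρ) ^ s)
  have hrem := norm_remainder_le (s := s) ht hρ hξ₀ x₀ happ N
  set P : L2 n := (memLp_packet hρ ξ₀ x₀).toLp with hP
  set A : ℝ := 2 * (1 / 2) ^ N + 2 * 4 ^ N * Real.exp (-(Real.pi / 578 * ρ)) with hA
  have hA0 : 0 ≤ A := by positivity
  have hPf : 𝓕 (𝓕⁻ P) = P := FourierTransform.fourier_fourierInv_eq P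
  have hS : MemLp (fun ξ => heatSymbol s t ξ * P ξ) 2 volume := memLp_heatSymbol_mul s t P
  have hSP : (fun ξ => heatSymbol s t ξ * P ξ) =ᵐ[volume]
      fun ξ => heatSymbol s t ξ * packet ρ ξ₀ x₀ ξ := by
    filter_upwards [(memLp_packet hρ ξ₀ x₀).coeFn_toLp] with ξ h
    rw [hP, h]
  have hheat : heatSemigroup s t (𝓕⁻ P) = 𝓕⁻ hS.toLp := by
    unfold heatSemigroup
    simp only [hPf]
  have hRae : ∀ᵐ ξ ∂(volume : Measure (E n)), ‖heatSymbol s t ξ * P ξ - truncPacket c N ρ ξ₀ x₀ ξ‖ ≤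
      A * Real.exp (-(Real.pi / (2 * ρ) * ‖ξ - ξ₀‖ ^ 2)) := by
    filter_upwards [hSP] with ξ h
    rw [h]
    exact hrem ξ
  have hRn := eLpNorm_le_of_norm_le_gaussian le_rfl hA0
    (by positivity : 0 < Real.pi / (2 * ρ)) ξ₀ hRae
  rw [show Real.pi / (2 * (Real.pi / (2 * ρ))) = ρ by field_simp] at hRn
  have hR : MemLp (fun ξ => heatSymbol s t ξ * P ξ - truncPacket c N ρ ξ₀ x₀ ξ) 2 volume :=
    ⟨hS.1.sub (continuous_truncPacket c N ρ ξ₀ x₀).aestronglyMeasurable,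
      hRn.trans_lt ENNReal.ofReal_lt_top⟩
  have hQ : MemLp (truncPacket c N ρ ξ₀ x₀) 2 volume := by
    have := hS.sub hR
    refine this.ae_eq (.of_forall fun ξ => ?_)
    simp
  -- The remainder `hR` is controlled by Plancherel on all of space, the truncated part `hQ`
  -- pointwise in `x`.
  have hsplit : hS.toLp = hR.toLp + hQ.toLp := by
    rw [← MemLp.toLp_add]
    refine MemLp.toLp_congr _ _ (.of_forall fun ξ => ?_)
    simp
  have hsplit' : heatSemigroup s t (𝓕⁻ P) = 𝓕⁻ hR.toLp + 𝓕⁻ hQ.toLp := by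
    rw [hheat, hsplit, FourierTransform.fourierInv_add]
  have hQae : (𝓕⁻ hQ.toLp : L2 n) =ᵐ[volume] 𝓕⁻ (truncPacket c N ρ ξ₀ x₀) := by
    have hi : Integrable (hQ.toLp : E n → ℂ) volume :=
      (integrable_truncPacket c N hρ ξ₀ x₀).congr hQ.coeFn_toLp.symm
    refine (fourierInv_ae_eq hQ.toLp hi).trans (.of_forall fun x => ?_)
    rw [Real.fourierInv_eq', Real.fourierInv_eq']
    refine integral_congr_ae ?_
    filter_upwards [hQ.coeFn_toLp] with ξ h
    rw [h]
  have hbound : ∀ᵐ x ∂(volume : Measure (E n)), ‖(𝓕⁻ hQ.toLp : L2 n) x‖ ≤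
      8 ^ N * ρ ^ ((n : ℝ) / 2) * Real.exp (-(Real.pi * ρ / 2 * ‖x - x₀‖ ^ 2)) := by
    filter_upwards [hQae] with x h
    rw [h]
    exact norm_fourierInv_truncPacket_le hc hρ hN hξ₀ x₀ x
  have hB0 : (0 : ℝ) ≤ 8 ^ N * ρ ^ ((n : ℝ) / 2) := by positivity
  have hfin : volume (ω ∩ Metric.ball x₀ L) ≠ ⊤ :=
    ((measure_mono inter_subset_right).trans_lt measure_ball_lt_top).ne
  have hnear : eLpNorm (𝓕⁻ hQ.toLp : L2 n) 2 ((volume.restrict ω).restrict (Metric.ball x₀ L)) ≤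
      ENNReal.ofReal (8 ^ N * ρ ^ ((n : ℝ) / 2) *
        (volume (ω ∩ Metric.ball x₀ L)).toReal ^ (1 / 2 : ℝ)) := by
    rw [Measure.restrict_restrict Metric.isOpen_ball.measurableSet, inter_comm]
    refine (eLpNorm_le_of_ae_bound (C := 8 ^ N * ρ ^ ((n : ℝ) / 2)) ?_).trans (le_of_eq ?_)
    · filter_upwards [ae_restrict_of_ae hbound] with x h
      refine h.trans (mul_le_of_le_one_right hB0 (Real.exp_le_one_iff.2 ?_))
      have : 0 ≤ Real.pi * ρ / 2 * ‖x - x₀‖ ^ 2 := by positivity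
      linarith
    · rw [Measure.restrict_apply_univ, mul_comm, ENNReal.ofReal_mul hB0,
        ← ENNReal.ofReal_rpow_of_nonneg ENNReal.toReal_nonneg (by norm_num),
        ENNReal.ofReal_toReal hfin]
      norm_num
  -- Half of the Gaussian exponent gives the decay in `L`; the other half is integrated.
  have hfar : eLpNorm (𝓕⁻ hQ.toLp : L2 n) 2 ((volume.restrict ω).restrict (Metric.ball x₀ L)ᶜ) ≤
      ENNReal.ofReal (8 ^ N * ρ ^ ((n : ℝ) / 2) * Real.exp (-(Real.pi * ρ / 4 * L ^ 2)) *
          (2 / ρ) ^ ((n : ℝ) / 4)) := by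
    have := eLpNorm_le_of_norm_le_gaussian (f := (𝓕⁻ hQ.toLp : L2 n))
      (μ := (volume.restrict ω).restrict (Metric.ball x₀ L)ᶜ)
      (A := 8 ^ N * ρ ^ ((n : ℝ) / 2) * Real.exp (-(Real.pi * ρ / 4 * L ^ 2)))
      (Measure.restrict_le_self.trans Measure.restrict_le_self) (by positivity)
      (by positivity : 0 < Real.pi * ρ / 4) x₀ (by
        filter_upwards [ae_restrict_of_ae (ae_restrict_of_ae hbound),
          ae_restrict_mem Metric.isOpen_ball.measurableSet.compl] with x h hx
        refine h.trans ?_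
        rw [mul_assoc (8 ^ N * ρ ^ ((n : ℝ) / 2)), ← Real.exp_add]
        refine mul_le_mul_of_nonneg_left (Real.exp_le_exp.2 ?_) hB0
        rw [mem_compl_iff, mem_ball_iff_norm, not_lt] at hx
        have : Real.pi * ρ / 4 * L ^ 2 ≤ Real.pi * ρ / 4 * ‖x - x₀‖ ^ 2 := by gcongr
        linarith)
    rwa [show Real.pi / (2 * (Real.pi * ρ / 4)) = 2 / ρ by field_simp; norm_num] at this
  have hRfin : eLpNorm (𝓕⁻ hR.toLp : L2 n) 2 (volume.restrict ω) ≤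
      ENNReal.ofReal (A * ρ ^ ((n : ℝ) / 4)) := by
    refine (eLpNorm_mono_measure _ Measure.restrict_le_self).trans (le_trans (le_of_eq ?_) hRn)
    have h1 : ‖(𝓕⁻ hR.toLp : L2 n)‖ = ‖hR.toLp‖ := by
      rw [← Lp.norm_fourier_eq, FourierTransform.fourier_fourierInv_eq]
    rw [Lp.norm_def, Lp.norm_def, ENNReal.toReal_eq_toReal_iff' (Lp.eLpNorm_ne_top _)
      (Lp.eLpNorm_ne_top _)] at h1
    rw [h1]
    exact eLpNorm_congr_ae hR.coeFn_toLp
  have hQfin : eLpNorm (𝓕⁻ hQ.toLp : L2 n) 2 (volume.restrict ω) ≤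
      eLpNorm (𝓕⁻ hQ.toLp : L2 n) 2 ((volume.restrict ω).restrict (Metric.ball x₀ L)) +
      eLpNorm (𝓕⁻ hQ.toLp : L2 n) 2 ((volume.restrict ω).restrict (Metric.ball x₀ L)ᶜ) := by
    have hm : MeasurableSet (Metric.ball x₀ L) := Metric.isOpen_ball.measurableSet
    rw [← eLpNorm_indicator_eq_eLpNorm_restrict hm, ← eLpNorm_indicator_eq_eLpNorm_restrict hm.compl]
    have hmeas : AEStronglyMeasurable (𝓕⁻ hQ.toLp : L2 n) (volume.restrict ω) :=
      (Lp.aestronglyMeasurable _).restrict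
    refine le_trans (le_of_eq ?_)
      (eLpNorm_add_le (hmeas.indicator hm) (hmeas.indicator hm.compl) (by norm_num))
    rw [indicator_self_add_compl]
  rw [hsplit', ENNReal.ofReal_add (by positivity) (by positivity),
    ENNReal.ofReal_add (by positivity) (by positivity),
    eLpNorm_congr_ae (ae_restrict_of_ae (Lp.coeFn_add _ _))]
  refine (eLpNorm_add_le (Lp.aestronglyMeasurable _).restrict
    (Lp.aestronglyMeasurable _).restrict (by norm_num)).trans ?_
  exact add_le_add hRfin (hQfin.trans (add_le_add hnear hfar))

/-- Only the unit ball about `ξ₀` is used: there `‖ξ‖ ≤ 2ρ` and the coherent state is at least `exp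
(-π)`. An inequality on `‖ξ₀‖` suffices, so `ξ₀ = 0` is available in dimension zero. -/
theorem norm_heatSemigroup_packet_ge {n : ℕ} {s T ρ : ℝ} (hs₀ : 0 < s)
    (hT : 0 ≤ T) (hρ : 1 ≤ ρ) {ξ₀ : E n} (hξ₀ : ‖ξ₀‖ ≤ ρ) (x₀ : E n) :
    Real.exp (-Real.pi) * (volume (Metric.ball (0 : E n) 1)).toReal ^ (1 / 2 : ℝ) *
        Real.exp (-(T * (4 * Real.pi) ^ s * ρ ^ s)) ≤
      ‖heatSemigroup s T (𝓕⁻ (memLp_packet (one_pos.trans_le hρ) ξ₀ x₀).toLp)‖ := by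
  set P : L2 n := (memLp_packet (one_pos.trans_le hρ) ξ₀ x₀).toLp with hP
  have hρ0 : 0 < ρ := one_pos.trans_le hρ
  have hPf : 𝓕 (𝓕⁻ P) = P := FourierTransform.fourier_fourierInv_eq P
  have hS : MemLp (fun ξ => heatSymbol s T ξ * P ξ) 2 volume := memLp_heatSymbol_mul s T P
  have hheat : ‖heatSemigroup s T (𝓕⁻ P)‖ = ‖hS.toLp‖ := by
    unfold heatSemigroup
    simp only [hPf]
    rw [← Lp.norm_fourier_eq, FourierTransform.fourier_fourierInv_eq]
  set a : ℝ := Real.exp (-Real.pi) * Real.exp (-(T * (4 * Real.pi) ^ s * ρ ^ s)) with ha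
  have ha0 : 0 < a := by positivity
  have hpt : ∀ᵐ ξ ∂(volume : Measure (E n)),
      ‖(Metric.ball ξ₀ 1).indicator (fun _ => a) ξ‖ ≤ ‖heatSymbol s T ξ * P ξ‖ := by
    filter_upwards [(memLp_packet hρ0 ξ₀ x₀).coeFn_toLp] with ξ h
    by_cases hξ : ξ ∈ Metric.ball ξ₀ 1
    · rw [indicator_of_mem hξ, Real.norm_of_nonneg ha0.le, hP, h, norm_mul, norm_packet, heatSymbol,
        max_eq_left hT, Complex.norm_real, Real.norm_eq_abs, Real.abs_exp, ha, mul_comm]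
      rw [mem_ball_iff_norm] at hξ
      have h1 : ‖ξ‖ ≤ 2 * ρ := by
        have := norm_le_norm_add_norm_sub' ξ ξ₀
        linarith
      refine mul_le_mul (Real.exp_le_exp.2 (neg_le_neg ?_)) (Real.exp_le_exp.2 (neg_le_neg ?_))
        (Real.exp_nonneg _) (Real.exp_nonneg _)
      · rw [mul_assoc T, ← Real.mul_rpow (by positivity) hρ0.le]
        refine mul_le_mul_of_nonneg_left (Real.rpow_le_rpow (by positivity) ?_ hs₀.le) hT
        nlinarith [Real.pi_pos]
      · calc Real.pi / ρ * ‖ξ - ξ₀‖ ^ 2 ≤ Real.pi * 1 := by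
              gcongr
              · exact div_le_self Real.pi_pos.le hρ
              · exact pow_le_one₀ (norm_nonneg _) hξ.le
          _ = Real.pi := mul_one _
    · rw [indicator_of_notMem hξ, norm_zero]; exact norm_nonneg _
  have h1 := eLpNorm_mono_ae (p := 2) hpt
  rw [eLpNorm_indicator_const Metric.isOpen_ball.measurableSet two_ne_zero ENNReal.ofNat_ne_top,
    Measure.addHaar_ball_center] at h1
  rw [hheat, Lp.norm_toLp]
  refine le_trans (le_of_eq ?_) (ENNReal.toReal_mono hS.2.ne h1)
  rw [ENNReal.toReal_mul, ← ENNReal.toReal_rpow, toReal_enorm, Real.norm_of_nonneg ha0.le, ha,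
    ENNReal.toReal_ofNat]
  ring

end FracHeat
-- Choice of parameters and conclusion.
open Filter Topology

namespace FracHeat

/-- The quantitative consequence of observability obtained by testing on coherent states. -/
theorem NullControllable.packet_estimate {n : ℕ} {s T : ℝ} {ω : Set (E n)} (hs₀ : 0 < s)
    (hs₁ : s < 1) (hT : 0 < T) (hω : NullMeasurableSet ω volume) (hn : n ≠ 0)
    (h : NullControllable s T ω) :
    ∃ C : ℝ, 0 ≤ C ∧ ∀ (ρ L : ℝ) (N : ℕ) (x₀ : E n), 1 ≤ ρ → 0 ≤ L → N ≤ Real.pi * ρ →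
      Real.exp (-Real.pi) * (volume (Metric.ball (0 : E n) 1)).toReal ^ (1 / 2 : ℝ) *
        Real.exp (-(T * (4 * Real.pi) ^ s * ρ ^ s)) ≤
      C * ((2 * (1 / 2) ^ N + 2 * 4 ^ N * Real.exp (-(Real.pi / 578 * ρ))) * ρ ^ ((n : ℝ) / 4) +
        (8 ^ N * ρ ^ ((n : ℝ) / 2) * (volume (ω ∩ Metric.ball x₀ L)).toReal ^ (1 / 2 : ℝ) +
        8 ^ N * ρ ^ ((n : ℝ) / 2) * Real.exp (-(Real.pi * ρ / 4 * L ^ 2)) *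
          (2 / ρ) ^ ((n : ℝ) / 4))) := by
  obtain ⟨C, hC, hobs⟩ := h.observability hT hω
  refine ⟨C, hC, fun ρ L N x₀ hρ hL hN => ?_⟩
  have hρ0 : 0 < ρ := one_pos.trans_le hρ
  -- A vector of norm `ρ` requires a coordinate; dimension zero is treated separately.
  have hξ₀ : ‖EuclideanSpace.single (⟨0, Nat.pos_of_ne_zero hn⟩ : Fin n) ρ‖ = ρ := by
    rw [PiLp.norm_single, Real.norm_of_nonneg hρ0.le]
  exact (norm_heatSemigroup_packet_ge hs₀ hT.le hρ hξ₀.le x₀).trans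
    (hobs _ _ (by positivity) fun t ht =>
      eLpNorm_heatSemigroup_packet_le hs₀ hs₁ ht.1 hρ0 hL hξ₀ x₀ hN ω)

theorem tendsto_rpow_mul_exp_neg_rpow {s : ℝ} (hs : 0 < s) (a : ℝ) :
    Tendsto (fun ρ : ℝ => ρ ^ a * Real.exp (-ρ ^ s)) atTop (𝓝 0) := by
  refine ((tendsto_rpow_mul_exp_neg_mul_atTop_nhds_zero (a / s) 1 one_pos).comp
    (tendsto_rpow_atTop hs)).congr' ?_
  filter_upwards [eventually_gt_atTop 0] with ρ hρ
  simp only [Function.comp, ← Real.rpow_mul hρ.le]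
  rw [mul_div_cancel₀ _ hs.ne', neg_one_mul]

theorem eventually_mul_rpow_le {s : ℝ} (hs₁ : s < 1) (a : ℝ) {b : ℝ} (hb : 0 < b) :
    ∀ᶠ ρ : ℝ in atTop, a * ρ ^ s ≤ b * ρ := by
  filter_upwards [(tendsto_rpow_atTop (sub_pos.2 hs₁)).eventually_ge_atTop (a / b),
    eventually_gt_atTop 0] with ρ h1 h2
  rw [div_le_iff₀ hb] at h1
  calc a * ρ ^ s ≤ ρ ^ (1 - s) * b * ρ ^ s :=
        mul_le_mul_of_nonneg_right h1 (Real.rpow_nonneg h2.le _)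
    _ = b * (ρ ^ (1 - s) * ρ ^ s) := by ring
    _ = b * ρ := by rw [← Real.rpow_add h2, sub_add_cancel, Real.rpow_one]

/-- Optimisation of the truncation order in the coherent state estimate. -/
theorem eventually_measure_lower_bound {s C c₀ A γ : ℝ} (n : ℕ) (hs₀ : 0 < s) (hs₁ : s < 1)
    (hC : 0 ≤ C) (hc₀ : 0 < c₀) (hA : 0 ≤ A) (hγ : 0 < γ) :
    ∃ c₁ > 0, ∀ᶠ ρ : ℝ in atTop, 1 ≤ ρ ∧ ∃ N : ℕ, N ≤ Real.pi * ρ ∧ ∀ V R : ℝ, 0 ≤ V →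
      R = 8 * (A + 1) * ρ ^ s →
      c₀ * Real.exp (-(A * ρ ^ s)) ≤
        C * ((2 * (1 / 2) ^ N + 2 * 4 ^ N * Real.exp (-(γ * ρ))) * ρ ^ ((n : ℝ) / 4) +
        (8 ^ N * ρ ^ ((n : ℝ) / 2) * V ^ (1 / 2 : ℝ) +
        8 ^ N * ρ ^ ((n : ℝ) / 2) * Real.exp (-R) * (2 / ρ) ^ ((n : ℝ) / 4))) →
      c₁ * Real.exp (-(14 * (A + 1) * ρ ^ s)) ≤ V := by
  set D : ℝ := C * (18 + 8 * 2 ^ ((n : ℝ) / 4)) with hD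
  have hD0 : 0 ≤ D := by positivity
  refine ⟨(c₀ / (16 * (C + 1))) ^ 2, by positivity, ?_⟩
  have ht := tendsto_rpow_mul_exp_neg_rpow hs₀ (n : ℝ)
  have ht' := ht.const_mul D
  rw [mul_zero] at ht'
  filter_upwards [eventually_ge_atTop 1, ht.eventually_le_const one_pos,
    ht'.eventually_le_const (half_pos hc₀), eventually_mul_rpow_le hs₁ (7 * (A + 1)) hγ,
    eventually_mul_rpow_le hs₁ (2 * (A + 1)) one_pos] with ρ hρ h1 h2 h3 h4
  -- The factor `2` gives `2^(-N) ≤ exp (-(A+1) ρ^s)`, beating the lower bound by `exp (-ρ^s)`,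
  -- which absorbs the powers of `ρ`. The price is `8^N ≤ 8 exp (6(A+1) ρ^s)`, which the coefficient
  -- `8` in `R` outweighs.
  refine ⟨hρ, ⌈2 * (A + 1) * ρ ^ s⌉₊, ?_, fun V R hV hR hmain => ?_⟩
  · have := Nat.ceil_lt_add_one (show 0 ≤ 2 * (A + 1) * ρ ^ s by positivity)
    nlinarith [Real.pi_gt_three]
  have hρ0 : 0 < ρ := one_pos.trans_le hρ
  set X := ρ ^ s with hX
  have hX0 : 0 < X := by positivity
  set N := ⌈2 * (A + 1) * X⌉₊ with hNdef
  have hN1 : 2 * (A + 1) * X ≤ N := Nat.le_ceil _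
  have hN2 : (N : ℝ) ≤ 2 * (A + 1) * X + 1 := (Nat.ceil_lt_add_one (by positivity)).le
  have hpow2 : (1 / 2 : ℝ) ^ N ≤ Real.exp (-((A + 1) * X)) := by
    have h5 : (1 / 2 : ℝ) ≤ Real.exp (-(1 / 2)) := by
      linarith [Real.add_one_le_exp (-(1 / 2 : ℝ))]
    calc (1 / 2 : ℝ) ^ N ≤ Real.exp (-(1 / 2)) ^ N := pow_le_pow_left₀ (by norm_num) h5 _
      _ = Real.exp (-(N / 2)) := by rw [← Real.exp_nat_mul]; congr 1; ring
      _ ≤ _ := Real.exp_le_exp.2 (by linarith)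
  have hpow8 : (8 : ℝ) ^ N ≤ 8 * Real.exp (6 * (A + 1) * X) := by
    have h5 : Real.log 8 ≤ 3 := by
      rw [show (8 : ℝ) = 2 ^ 3 by norm_num, Real.log_pow]
      have := Real.log_two_lt_d9
      push_cast
      linarith
    rw [← Real.rpow_natCast]
    calc (8 : ℝ) ^ (N : ℝ) ≤ 8 ^ (2 * (A + 1) * X + 1) :=
          Real.rpow_le_rpow_of_exponent_le (by norm_num) hN2
      _ = 8 * 8 ^ (2 * (A + 1) * X) := by
          rw [Real.rpow_add (by norm_num), Real.rpow_one, mul_comm]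
      _ ≤ _ := by
          rw [Real.rpow_def_of_pos (by norm_num)]
          have : Real.log 8 * (2 * (A + 1) * X) ≤ 3 * (2 * (A + 1) * X) :=
            mul_le_mul_of_nonneg_right h5 (by positivity)
          exact mul_le_mul_of_nonneg_left (Real.exp_le_exp.2 (by linarith)) (by norm_num)
  have hpow4 : (4 : ℝ) ^ N ≤ 8 * Real.exp (6 * (A + 1) * X) :=
    (pow_le_pow_left₀ (by norm_num) (by norm_num) _).trans hpow8
  have hr4 : ρ ^ ((n : ℝ) / 4) ≤ ρ ^ (n : ℝ) :=
    Real.rpow_le_rpow_of_exponent_le hρ (by linarith [show (0 : ℝ) ≤ n by positivity])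
  have hr2 : ρ ^ ((n : ℝ) / 2) ≤ ρ ^ (n : ℝ) :=
    Real.rpow_le_rpow_of_exponent_le hρ (by linarith [show (0 : ℝ) ≤ n by positivity])
  have e1 : (2 * (1 / 2 : ℝ) ^ N + 2 * 4 ^ N * Real.exp (-(γ * ρ))) * ρ ^ ((n : ℝ) / 4) ≤
      18 * Real.exp (-((A + 1) * X)) * ρ ^ (n : ℝ) := by
    refine mul_le_mul ?_ hr4 (by positivity) (by positivity)
    have : (4 : ℝ) ^ N * Real.exp (-(γ * ρ)) ≤ 8 * Real.exp (-((A + 1) * X)) := by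
      calc _ ≤ 8 * Real.exp (6 * (A + 1) * X) * Real.exp (-(γ * ρ)) := by gcongr
        _ = 8 * Real.exp (6 * (A + 1) * X - γ * ρ) := by rw [mul_assoc, ← Real.exp_add, sub_eq_add_neg]
        _ ≤ _ := by gcongr; linarith
    linarith
  have e3 : 8 ^ N * ρ ^ ((n : ℝ) / 2) * Real.exp (-R) * (2 / ρ) ^ ((n : ℝ) / 4) ≤
      8 * 2 ^ ((n : ℝ) / 4) * Real.exp (-((A + 1) * X)) * ρ ^ (n : ℝ) := by
    calc _ ≤ 8 * Real.exp (6 * (A + 1) * X) * ρ ^ (n : ℝ) * Real.exp (-R) * 2 ^ ((n : ℝ) / 4) := by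
          gcongr
          exact div_le_self (by norm_num) hρ
      _ = 8 * 2 ^ ((n : ℝ) / 4) * Real.exp (6 * (A + 1) * X + -R) * ρ ^ (n : ℝ) := by
          rw [Real.exp_add]; ring
      _ ≤ _ := by
          gcongr
          rw [hR]
          nlinarith [mul_pos (show 0 < A + 1 by linarith) hX0]
  have e2 : 8 ^ N * ρ ^ ((n : ℝ) / 2) * V ^ (1 / 2 : ℝ) ≤
      8 * Real.exp (6 * (A + 1) * X) * ρ ^ (n : ℝ) * V ^ (1 / 2 : ℝ) := by gcongr
  have hsplit : Real.exp (-((A + 1) * X)) = Real.exp (-(A * X)) * Real.exp (-X) := by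
    rw [← Real.exp_add]; ring_nf
  have hsum : c₀ * Real.exp (-(A * X)) ≤
      D * (ρ ^ (n : ℝ) * Real.exp (-X)) * Real.exp (-(A * X)) +
      C * (8 * Real.exp (6 * (A + 1) * X) * ρ ^ (n : ℝ) * V ^ (1 / 2 : ℝ)) := by
    refine hmain.trans ((mul_le_mul_of_nonneg_left (add_le_add e1 (add_le_add e2 e3)) hC).trans
      (le_of_eq ?_))
    rw [hsplit, hD]
    ring
  have hhalf : c₀ / 2 * Real.exp (-(A * X)) ≤
      C * (8 * Real.exp (6 * (A + 1) * X) * ρ ^ (n : ℝ) * V ^ (1 / 2 : ℝ)) := by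
    have := mul_le_mul_of_nonneg_right h2 (Real.exp_nonneg (-(A * X)))
    linarith
  have hρn : ρ ^ (n : ℝ) ≤ Real.exp X := by
    rw [Real.exp_neg, ← div_eq_mul_inv, div_le_one (Real.exp_pos _)] at h1
    exact h1
  -- The exponent collects `A + 6(A+1) + 1 = 7(A+1)`; squaring gives `14(A+1)`. Using `C + 1` avoids
  -- division by zero.
  have hroot : c₀ / (16 * (C + 1)) * Real.exp (-(7 * (A + 1) * X)) ≤ V ^ (1 / 2 : ℝ) := by
    have h5 : c₀ / 2 * Real.exp (-(A * X)) ≤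
        8 * (C + 1) * V ^ (1 / 2 : ℝ) * Real.exp ((6 * (A + 1) + 1) * X) := by
      calc _ ≤ (C + 1) * (8 * Real.exp (6 * (A + 1) * X) * Real.exp X * V ^ (1 / 2 : ℝ)) := by
            refine hhalf.trans ?_
            gcongr
            linarith
        _ = _ := by rw [add_mul (6 * (A + 1)), one_mul, Real.exp_add]; ring
    have h6 := mul_le_mul_of_nonneg_right h5 (Real.exp_nonneg (-((6 * (A + 1) + 1) * X)))
    rw [mul_assoc, ← Real.exp_add, mul_assoc _ (Real.exp _), ← Real.exp_add, add_neg_cancel,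
      Real.exp_zero, mul_one] at h6
    rw [div_mul_eq_mul_div, div_le_iff₀ (by positivity)]
    rw [show -(A * X) + -((6 * (A + 1) + 1) * X) = -(7 * (A + 1) * X) by ring] at h6
    linarith
  have h7 := pow_le_pow_left₀ (by positivity) hroot 2
  rw [mul_pow, ← Real.exp_nat_mul, ← Real.rpow_natCast (V ^ _), ← Real.rpow_mul hV] at h7
  norm_num at h7
  rwa [show 2 * (7 * (A + 1) * X) = 14 * (A + 1) * X by ring] at h7

theorem toReal_volume_ball_rpow_pos (n : ℕ) :
    0 < (volume (Metric.ball (0 : E n) 1)).toReal ^ (1 / 2 : ℝ) :=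
  Real.rpow_pos_of_pos (ENNReal.toReal_pos (Metric.measure_ball_pos _ _ one_pos).ne'
    measure_ball_lt_top.ne) _

/-- On a null set every positive `M` is admissible in the observability bound, which would force a
nonzero evolved state to vanish. This is what dimension zero needs. -/
theorem NullControllable.volume_ne_zero {n : ℕ} {s T : ℝ} {ω : Set (E n)} (hs₀ : 0 < s)
    (hT : 0 < T) (hω : NullMeasurableSet ω volume) (h : NullControllable s T ω) :
    volume ω ≠ 0 := by
  intro h0
  obtain ⟨C, hC, hobs⟩ := h.observability hT hω
  have hlow := norm_heatSemigroup_packet_ge (n := n) hs₀ hT.le le_rfl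
    (norm_zero.trans_le zero_le_one) 0
  set c := ‖heatSemigroup s T (𝓕⁻ (memLp_packet one_pos (0 : E n) 0).toLp)‖
  have hc : 0 < c := lt_of_lt_of_le (mul_pos (mul_pos (Real.exp_pos _)
    (toReal_volume_ball_rpow_pos n)) (Real.exp_pos _)) hlow
  have h1 : c ≤ C * (c / (C + 1) / 2) := hobs _ _ (by positivity) fun t _ => by
    rw [Measure.restrict_eq_zero.2 h0, eLpNorm_measure_zero]
    exact zero_le
  have h2 : C * (c / (C + 1) / 2) ≤ c / 2 := by
    rw [← mul_div_assoc, ← mul_div_assoc]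
    gcongr
    rw [div_le_iff₀ (by positivity)]
    nlinarith
  linarith

theorem exponentiallyThick_of_dim_zero {α : ℝ} {ω : Set (E 0)} (hω : NullMeasurableSet ω volume)
    (h0 : volume ω ≠ 0) : ExponentiallyThick α ω := by
  have huniv : ω = univ := Subsingleton.eq_univ_of_nonempty (nonempty_of_measure_ne_zero h0)
  refine ⟨hω, 1, one_pos, 1, one_pos, 1, one_pos, fun L hL _ x => ?_⟩
  rw [huniv, univ_inter]
  refine mul_le_of_le_one_left zero_le (ENNReal.ofReal_le_one.2 ?_)
  rw [one_mul, Real.exp_le_one_iff]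
  have := Real.rpow_nonneg hL.le (-α)
  linarith

theorem NullControllable.exponentiallyThick {n : ℕ} {s T : ℝ} {ω : Set (E n)} (hs₀ : 0 < s)
    (hs₁ : s < 1) (hT : 0 < T) (hω : NullMeasurableSet ω volume) (hn : n ≠ 0)
    (h : NullControllable s T ω) : ExponentiallyThick (2 * s / (1 - s)) ω := by
  obtain ⟨C, hC, hest⟩ := h.packet_estimate hs₀ hs₁ hT hω hn
  obtain ⟨c₁, hc₁, hev⟩ := eventually_measure_lower_bound (A := T * (4 * Real.pi) ^ s) n hs₀ hs₁ hC
    (mul_pos (Real.exp_pos (-Real.pi)) (toReal_volume_ball_rpow_pos n)) (by positivity)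
    (by positivity : 0 < Real.pi / 578)
  set A := T * (4 * Real.pi) ^ s with hA
  have hA0 : 0 < A := by positivity
  have hs1 : 0 < 1 - s := by linarith
  -- Solves `π ρ L² / 4 = 8 (A+1) ρ^s` for `ρ`, that is `ρ^(1-s) = m / L²`.
  obtain ⟨m, hm⟩ : ∃ m : ℝ, m = 32 * (A + 1) / Real.pi := ⟨_, rfl⟩
  have hm0 : 0 < m := by rw [hm]; positivity
  have htend : Tendsto (fun L : ℝ => (m * (L ^ 2)⁻¹) ^ (1 / (1 - s))) (𝓝[>] 0) atTop := by
    refine (tendsto_rpow_atTop (by positivity)).comp (Tendsto.const_mul_atTop hm0 ?_)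
    refine tendsto_inv_nhdsGT_zero.comp (tendsto_nhdsWithin_iff.2 ⟨?_, ?_⟩)
    · have : Tendsto (fun L : ℝ => L ^ 2) (𝓝 0) (𝓝 (0 ^ 2)) := (continuous_pow 2).tendsto 0
      rw [zero_pow two_ne_zero] at this
      exact this.mono_left nhdsWithin_le_nhds
    · filter_upwards [self_mem_nhdsWithin] with L hL
      exact pow_pos (mem_Ioi.1 hL) 2
  obtain ⟨δ, hδ, hδL⟩ := mem_nhdsGT_iff_exists_Ioo_subset.1 (htend.eventually hev)
  set v := (volume (Metric.ball (0 : E n) 1)).toReal with hv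
  have hv0 : 0 < v := ENNReal.toReal_pos (Metric.measure_ball_pos _ _ one_pos).ne'
    measure_ball_lt_top.ne
  -- The cap `L < 1` bounds the volume of the ball by `v`, which is divided out of `c₁`.
  refine ⟨hω, 14 * (A + 1) * m ^ (s / (1 - s)), by positivity, c₁ / v, by positivity, min δ 1,
    lt_min hδ one_pos, fun L hL hL' x => ?_⟩
  obtain ⟨hρ1, N, hN, hfin⟩ := hδL ⟨hL, hL'.trans_le (min_le_left _ _)⟩
  set ρ := (m * (L ^ 2)⁻¹) ^ (1 / (1 - s)) with hρ
  have hρ0 : 0 < ρ := by positivity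
  have hρs : ρ ^ s = m ^ (s / (1 - s)) * L ^ (-(2 * s / (1 - s))) := by
    rw [hρ, ← Real.rpow_mul (by positivity), Real.mul_rpow (by positivity) (by positivity),
      ← Real.rpow_natCast, ← Real.rpow_neg hL.le, ← Real.rpow_mul hL.le]
    congr 2 <;> field_simp
    push_cast
    ring
  have hρL : Real.pi * ρ / 4 * L ^ 2 = 8 * (A + 1) * ρ ^ s := by
    have h1 : ρ ^ (1 - s) = m * (L ^ 2)⁻¹ := by
      rw [hρ, ← Real.rpow_mul (by positivity), one_div, inv_mul_cancel₀ hs1.ne', Real.rpow_one]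
    have h2 : ρ = ρ ^ (1 - s) * ρ ^ s := by
      rw [← Real.rpow_add hρ0, sub_add_cancel, Real.rpow_one]
    have h3 : Real.pi * m = 32 * (A + 1) := by rw [hm]; field_simp
    calc Real.pi * ρ / 4 * L ^ 2 = Real.pi * (m * (L ^ 2)⁻¹ * ρ ^ s) / 4 * L ^ 2 := by
          rw [← h1, ← h2]
      _ = Real.pi * m * ρ ^ s / 4 * ((L ^ 2)⁻¹ * L ^ 2) := by ring
      _ = _ := by rw [inv_mul_cancel₀ (by positivity), h3]; ring
  have key := hfin (volume (ω ∩ Metric.ball x L)).toReal _ ENNReal.toReal_nonneg hρL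
    (hest ρ L N x hρ1 hL.le hN)
  have hball : volume (Metric.ball x L) ≤ ENNReal.ofReal v := by
    rw [hv, ENNReal.ofReal_toReal measure_ball_lt_top.ne, ← Measure.addHaar_ball_center volume x 1]
    exact measure_mono (Metric.ball_subset_ball (hL'.le.trans (min_le_right _ _)))
  have hne : volume (ω ∩ Metric.ball x L) ≠ ⊤ :=
    ((measure_mono inter_subset_right).trans_lt measure_ball_lt_top).ne
  calc _ ≤ ENNReal.ofReal (c₁ / v * Real.exp (-(14 * (A + 1) * m ^ (s / (1 - s))) *
        L ^ (-(2 * s / (1 - s))))) * ENNReal.ofReal v := by gcongr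
    _ = ENNReal.ofReal (c₁ * Real.exp (-(14 * (A + 1) * ρ ^ s))) := by
        rw [← ENNReal.ofReal_mul (by positivity), hρs]
        congr 1
        rw [show -(14 * (A + 1) * m ^ (s / (1 - s))) * L ^ (-(2 * s / (1 - s))) =
          -(14 * (A + 1) * (m ^ (s / (1 - s)) * L ^ (-(2 * s / (1 - s))))) by ring]
        field_simp
    _ ≤ _ := by
        rw [← ENNReal.ofReal_toReal hne]
        exact ENNReal.ofReal_le_ofReal key

end FracHeat

theorem theorem1 (n : ℕ) (s T : ℝ) (hs₀ : 0 < s) (hs₁ : s < 1) (hT : 0 < T)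
    (ω : Set (EuclideanSpace ℝ (Fin n))) (hω : NullMeasurableSet ω volume)
    (h : FracHeat.NullControllable s T ω) :
    FracHeat.ExponentiallyThick (2 * s / (1 - s)) ω := by
  rcases eq_or_ne n 0 with rfl | hn
  · exact FracHeat.exponentiallyThick_of_dim_zero hω (h.volume_ne_zero hs₀ hT hω)
  · exact h.exponentiallyThick hs₀ hs₁ hT hω hn
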